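/- Let $\Lambda\subset\mathbb Z$ be a finite non-empty set with $-\Lambda=\Lambda$, let $S=\{z\in\mathbb C:|z|=1\}$, and let $V_\Lambda$ be the real vector space of real Laurent polynomials with spectrum $\Lambda$, i.e. of the functions $f(z)=\sum_{m\in\Lambda}a_mz^m$ on $\mathbb C\setminus\{0\}$, $a_m\in\mathbb C$, whose values on $S$ are real. Equip $V_\Lambda$ with the scalar product $(f,g)=\frac1{2\pi}\int_0^{2\pi}f(e^{i\theta})g(e^{i\theta})\,d\theta$, and let $f_\Lambda$ be a random element of $V_\Lambda$ distributed according to the standard normal distribution of this Euclidean space. A root of $f$ is a point $z\in\mathbb C\setminus\{0\}$ with $f(z)=0$; a real root is a root lying on $S$. Put $\deg(f_\Lambda)=\max_{\lambda\in\Lambda}|\lambda|$. If $\Lambda\neq\{0\}$, let $\mathcal P(\Lambda)$ be the probability that a root of $f_\Lambda$ is real, i.e. the expectation of the ratio (number of real roots of $f_\Lambda$)/(number of roots of $f_\Lambda$). Then: (a) the number of real roots of $f_\Lambda$ is integrable, and its expectation is $$2\sqrt{\frac1{\#\Lambda}\sum_{\lambda\in\Lambda}\lambda^2}\,;$$ (b)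 if $\Lambda\ne\{0\}$, then $$\mathcal P(\Lambda)=\frac1{\deg(f_\Lambda)}\sqrt{\frac1{\#\Lambda}\sum_{\lambda\in\Lambda}\lambda^2}\,;$$ (c) if $\Lambda\ne\{0\}$, then $\mathcal P(k\Lambda)=\mathcal P(\Lambda)$ for every integer $k\neq0$. -/

import Mathlib

open MeasureTheory ProbabilityTheory
open scoped LaurentPolynomial Real

noncomputable section

namespace RandomLaurent

/-- The value `P(z)` of a complex Laurent polynomial at a point `z ∈ ℂ ∖ {0}`. -/
def value (P : ℂ[T;T⁻¹]) (z : ℂˣ) : ℂ :=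
  LaurentPolynomial.eval₂ (RingHom.id ℂ) z P

lemma value_add (P Q : ℂ[T;T⁻¹]) (z : ℂˣ) : value (P + Q) z = value P z + value Q z :=
  map_add _ _ _

lemma value_smul (c : ℝ) (P : ℂ[T;T⁻¹]) (z : ℂˣ) : value (c • P) z = c * value P z := by
  have h : c • P = LaurentPolynomial.C (c : ℂ) * P := by
    rw [← LaurentPolynomial.smul_eq_C_mul]
    ext n
    simp
  rw [h, value, map_mul, LaurentPolynomial.eval₂_C]
  rfl

/-- The real vector space of real Laurent polynomials with spectrum `Λ`: the Laurent polynomials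
`∑_{m ∈ Λ} a_m z^m` with complex coefficients whose values on the unit circle are real. -/
def realLaurent (Λ : Finset ℤ) : Submodule ℝ ℂ[T;T⁻¹] where
  carrier := {P | (∀ m : ℤ, m ∉ Λ → P.coeff m = 0) ∧
    ∀ z : ℂˣ, ‖(z : ℂ)‖ = 1 → (value P z).im = 0}
  add_mem' := by
    rintro P Q ⟨hP, hP'⟩ ⟨hQ, hQ'⟩
    refine ⟨fun m hm => ?_, fun z hz => ?_⟩
    · simp [hP m hm, hQ m hm]
    · simp [value_add, hP' z hz, hQ' z hz]
  zero_mem' := ⟨fun m _ => by simp, fun z _ => by simp [value]⟩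
  smul_mem' := by
    rintro c P ⟨hP, hP'⟩
    refine ⟨fun m hm => ?_, fun z hz => ?_⟩
    · simp [hP m hm]
    · simp [value_smul, hP' z hz]

/-- The trigonometric polynomial `θ ↦ P(e^{iθ})` given by the restriction of a real Laurent
polynomial `P` to the unit circle (these values are real, so nothing is lost by `re`). -/
def trig {Λ : Finset ℤ} (P : realLaurent Λ) (θ : ℝ) : ℝ :=
  (value P (Circle.toUnits (Circle.exp θ))).re

lemma trig_add {Λ : Finset ℤ} (P Q : realLaurent Λ) (θ : ℝ) :
    trig (P + Q) θ = trig P θ + trig Q θ := by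
  simp [trig, value_add]

lemma trig_smul {Λ : Finset ℤ} (c : ℝ) (P : realLaurent Λ) (θ : ℝ) :
    trig (c • P) θ = c * trig P θ := by
  simp [trig, value_smul]

lemma continuous_value_circle (P : ℂ[T;T⁻¹]) :
    Continuous fun θ : ℝ => value P (Circle.toUnits (Circle.exp θ)) := by
  induction P using LaurentPolynomial.induction_on' with
  | add P Q hP hQ =>
    simp only [value_add]
    exact hP.add hQ
  | C_mul_T n a =>
    simp only [value, LaurentPolynomial.eval₂_C_mul_T, Units.val_zpow_eq_zpow_val,
      Circle.toUnits_apply, Units.val_mk0]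
    exact continuous_const.mul ((continuous_subtype_val.comp Circle.exp.continuous).zpow₀ n
      fun θ => Or.inl (Circle.coe_ne_zero _))

lemma continuous_trig {Λ : Finset ℤ} (P : realLaurent Λ) : Continuous (trig P) :=
  Complex.continuous_re.comp (continuous_value_circle P)

/-- A Laurent polynomial with infinitely many roots vanishes. -/
lemma eq_zero_of_infinite (P : ℂ[T;T⁻¹]) (h : {z : ℂˣ | value P z = 0}.Infinite) : P = 0 := by
  obtain ⟨n, p, hp⟩ := P.exists_T_pow
  have hp0 : p = 0 := by
    refine Polynomial.eq_zero_of_infinite_isRoot p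
      ((h.image (Units.val_injective.injOn)).mono ?_)
    rintro _ ⟨z, hz, rfl⟩
    have h1 := congrArg (LaurentPolynomial.eval₂ (RingHom.id ℂ) z) hp
    rw [LaurentPolynomial.eval₂_toLaurent, map_mul] at h1
    have h2 : LaurentPolynomial.eval₂ (RingHom.id ℂ) z P = 0 := hz
    rw [h2, zero_mul] at h1
    exact h1
  rw [hp0, map_zero] at hp
  exact ((LaurentPolynomial.isUnit_T (R := ℂ) (n : ℤ)).mul_left_eq_zero).1 hp.symm

lemma eq_zero_of_trig {Λ : Finset ℤ} (P : realLaurent Λ)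
    (h : ∀ θ ∈ Set.Ioo (0 : ℝ) (2 * π), trig P θ = 0) : P = 0 := by
  apply Subtype.ext
  refine eq_zero_of_infinite _ ?_
  have hinj : Set.InjOn (fun θ : ℝ => Circle.toUnits (Circle.exp θ)) (Set.Ioo 0 π) := by
    intro x hx y hy hxy
    have h1 : ((Circle.exp x : Circle) : ℂ) = Circle.exp y := congrArg Units.val hxy
    rw [← Circle.arg_exp (by linarith [hx.1, Real.pi_pos]) hx.2.le, h1,
      Circle.arg_exp (by linarith [hy.1, Real.pi_pos]) hy.2.le]
  refine ((Set.Ioo_infinite Real.pi_pos).image hinj).mono ?_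
  rintro _ ⟨θ, hθ, rfl⟩
  refine Complex.ext (h θ ⟨hθ.1, by linarith [hθ.2, Real.pi_pos]⟩) (P.2.2 _ ?_)
  simp

/-- The scalar product `(f, g) = (1 / 2π) ∫_S f g` of `L₂(S)`. -/
@[reducible] def innerCore (Λ : Finset ℤ) : InnerProductSpace.Core ℝ (realLaurent Λ) where
  inner P Q := (1 / (2 * π)) * ∫ θ in (0 : ℝ)..(2 * π), trig P θ * trig Q θ
  conj_inner_symm P Q := by
    simp [mul_comm]
  re_inner_nonneg P := by
    have h : 0 ≤ ∫ θ in (0 : ℝ)..(2 * π), trig P θ * trig P θ :=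
      intervalIntegral.integral_nonneg (by positivity) fun θ _ => mul_self_nonneg _
    simp only [RCLike.re_to_real]
    positivity
  add_left P Q R := by
    have hi : ∀ A B : realLaurent Λ, IntervalIntegrable (fun θ => trig A θ * trig B θ)
        volume 0 (2 * π) := fun A B =>
      ((continuous_trig A).mul (continuous_trig B)).intervalIntegrable _ _
    simp only [trig_add, add_mul]
    rw [intervalIntegral.integral_add (hi P R) (hi Q R)]
    ring
  smul_left P Q c := by
    simp only [trig_smul, mul_assoc, intervalIntegral.integral_const_mul, conj_trivial]
    ring
  definite P h := by
    apply eq_zero_of_trig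
    by_contra! hne
    obtain ⟨θ, hθ, hθ0⟩ := hne
    have hpos : 0 < ∫ θ in (0 : ℝ)..(2 * π), trig P θ * trig P θ :=
      intervalIntegral.integral_pos (by positivity)
        ((continuous_trig P).mul (continuous_trig P)).continuousOn
        (fun _ _ => mul_self_nonneg _)
        ⟨θ, Set.Ioo_subset_Icc_self hθ, mul_self_pos.2 hθ0⟩
    have : 0 < (1 / (2 * π)) * ∫ θ in (0 : ℝ)..(2 * π), trig P θ * trig P θ := by positivity
    exact this.ne' h

instance normedInst (Λ : Finset ℤ) : NormedAddCommGroup (realLaurent Λ) :=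
  (innerCore Λ).toNormedAddCommGroup

instance innerInst (Λ : Finset ℤ) : InnerProductSpace ℝ (realLaurent Λ) :=
  InnerProductSpace.ofCore (innerCore Λ).toCore

instance finiteDimInst (Λ : Finset ℤ) : FiniteDimensional ℝ (realLaurent Λ) := by
  let L : realLaurent Λ →ₗ[ℝ] (Λ → ℂ) :=
    { toFun := fun P m => (P : ℂ[T;T⁻¹]).coeff m
      map_add' := fun P Q => by ext m; simp
      map_smul' := fun c P => by ext m; simp }
  refine FiniteDimensional.of_injective L fun P Q h => ?_
  apply Subtype.ext
  ext m
  by_cases hm : m ∈ Λ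
  · exact congrFun h ⟨m, hm⟩
  · rw [P.2.1 m hm, Q.2.1 m hm]

instance measurableInst (Λ : Finset ℤ) : MeasurableSpace (realLaurent Λ) := borel _

instance borelInst (Λ : Finset ℤ) : BorelSpace (realLaurent Λ) := ⟨rfl⟩

/-- The law of a random real Laurent polynomial with spectrum `Λ`: the standard normal distribution
of the Euclidean space `realLaurent Λ` with the metric of `L₂(S)`. -/
def law (Λ : Finset ℤ) : Measure (realLaurent Λ) := stdGaussian (realLaurent Λ)

/-- The roots of a Laurent polynomial in `ℂ ∖ {0}`. -/
def roots (P : ℂ[T;T⁻¹]) : Set ℂˣ := {z | value P z = 0}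

/-- The real roots of a Laurent polynomial: its roots on the unit circle. -/
def realRoots (P : ℂ[T;T⁻¹]) : Set ℂˣ := {z | z ∈ roots P ∧ ‖(z : ℂ)‖ = 1}

/-- The number of real roots. -/
def numRealRoots {Λ : Finset ℤ} (P : realLaurent Λ) : ℝ := (realRoots P).ncard

/-- The probability that a root of a random real Laurent polynomial with spectrum `Λ` is real:
the polynomial is drawn from `law Λ`, then a root is drawn uniformly from its finite set of roots,
so this is the expectation of the proportion of real roots among all roots. -/
def probRootReal (Λ : Finset ℤ) : ℝ :=
  ∫ P : realLaurent Λ, numRealRoots P / ((roots (P : ℂ[T;T⁻¹])).ncard : ℝ) ∂(law Λ)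

/-- The degree `max_{k ∈ Λ} |k|` of a real Laurent polynomial with spectrum `Λ`. -/
def degree (Λ : Finset ℤ) : ℕ := Λ.sup Int.natAbs

end RandomLaurent

end

/-!
The values of a real Laurent polynomial on the unit circle are scalar products with evaluation
vectors, `f(e^{iθ}) = ⟪v θ, f⟫`. Two nonzero linear functionals of a standard Gaussian vector have
opposite signs with probability `angle / π`, so the expected number of sign changes of
`θ ↦ f(e^{iθ})` along a uniform grid is `1 / π` times the angular length of the polygon inscribed in
the curve `v`. As the grid is refined this tends to `1 / π` times the angular length of `v`, which
is `2 √(∑ λ² / #Λ)`. The number of sign changes itself tends to the number of real roots as soon as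
these are simple.

Roots are almost surely simple and almost surely `2d` in number, where `d` is the degree: on every
line in the direction of `z^d + z^{-d}` a multiple root occurs for finitely many parameters only,
because at a multiple root of `g + t h` the Wronskian of `g` and `h` vanishes, and a standard
Gaussian measure does not charge a Borel set meeting all lines of a fixed direction in countable
sets.
-/

noncomputable section

namespace RandomLaurent

open Filter Topology ComplexConjugate
open scoped RealInnerProductSpace

section Gaussian

variable {E : Type*} [NormedAddCommGroup E] [InnerProductSpace ℝ E]

lemma angle_eq_two_mul_arcsin {u v : E} (hu : u ≠ 0) (h : ‖u‖ = ‖v‖) :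
    InnerProductGeometry.angle u v = 2 * Real.arcsin (‖u - v‖ / (2 * ‖u‖)) := by
  have := norm_pos_iff.2 hu
  have chord_nonneg : 0 ≤ ‖u - v‖ / (2 * ‖u‖) := by positivity
  have chord_le_one : ‖u - v‖ / (2 * ‖u‖) ≤ 1 := by
    rw [div_le_one (by positivity), two_mul]
    nth_rw 2 [h]
    exact norm_sub_le u v
  have arcsin_nonneg := Real.arcsin_nonneg.2 chord_nonneg
  have arcsin_le := Real.arcsin_le_pi_div_two (‖u - v‖ / (2 * ‖u‖))
  rw [InnerProductGeometry.angle,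
    ← Real.arccos_cos (x := 2 * Real.arcsin _) (by linarith) (by linarith), Real.cos_two_mul',
    Real.cos_sq', Real.sin_arcsin (by linarith) chord_le_one, ← h, div_pow,
    norm_sub_sq_real, ← h]
  congr 1
  field_simp
  ring

lemma dual_comp_innerSL_prod (L : StrongDual ℝ (ℝ × ℝ)) (u v : E) :
    L.comp ((innerSL ℝ u).prod (innerSL ℝ v)) = innerSL ℝ (L (1, 0) • u + L (0, 1) • v) := by
  ext f
  have hL : L (⟪u, f⟫, ⟪v, f⟫) = ⟪u, f⟫ • L (1, 0) + ⟪v, f⟫ • L (0, 1) := by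
    rw [← map_smul, ← map_smul, ← map_add]
    simp
  simp [hL, mul_comm]

variable [FiniteDimensional ℝ E] [MeasurableSpace E] [BorelSpace E]

lemma map_stdGaussian_dual (L : StrongDual ℝ E) :
    (stdGaussian E).map L = gaussianReal 0 (‖L‖ ^ 2).toNNReal := by
  rw [IsGaussian.map_eq_gaussianReal, integral_strongDual_stdGaussian, variance_dual_stdGaussian]

lemma stdGaussian_preimage_eq_zero_of_countable {L : StrongDual ℝ E} (hL : L ≠ 0) {C : Set ℝ}
    (hC : C.Countable) : stdGaussian E (L ⁻¹' C) = 0 := by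
  have hvar : (‖L‖ ^ 2).toNNReal ≠ 0 := by
    simpa using hL
  have := nullSingletonClass_gaussianReal (μ := 0) hvar
  rw [← Measure.map_apply L.measurable hC.measurableSet, map_stdGaussian_dual]
  exact hC.measure_zero _

lemma charFun_map_starProjection (μ : Measure E) (K : Submodule ℝ E) (s : E) :
    charFun (μ.map K.starProjection) s = charFun μ (K.starProjection s) := by
  rw [charFun_apply, charFun_apply, integral_map (by fun_prop) (by fun_prop)]
  simp only [Submodule.inner_starProjection_left_eq_right]

lemma stdGaussian_eq_conv_starProjection (K : Submodule ℝ E) :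
    stdGaussian E =
      (stdGaussian E).map Kᗮ.starProjection ∗ (stdGaussian E).map K.starProjection := by
  have := Measure.isProbabilityMeasure_map (μ := stdGaussian E)
    K.starProjection.continuous.aemeasurable
  have := Measure.isProbabilityMeasure_map (μ := stdGaussian E)
    Kᗮ.starProjection.continuous.aemeasurable
  refine Measure.ext_of_charFun (funext fun s => ?_)
  have pythagoras : (‖s‖ : ℂ) ^ 2 = ‖K.starProjection s‖ ^ 2 + ‖Kᗮ.starProjection s‖ ^ 2 :=
    mod_cast Submodule.norm_sq_eq_add_norm_sq_starProjection s K
  rw [charFun_conv, charFun_map_starProjection, charFun_map_starProjection]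
  simp only [charFun_stdGaussian]
  rw [← Complex.exp_add, pythagoras]
  ring_nf

lemma stdGaussian_eq_zero_of_countable_lines {B : Set E} (hB : MeasurableSet B) {h : E}
    (hh : h ≠ 0) (hc : ∀ g : E, {t : ℝ | g + t • h ∈ B}.Countable) : stdGaussian E B = 0 := by
  have hadd : MeasurableSet ((fun x : E × E => x.1 + x.2) ⁻¹' B) := hB.preimage (by fun_prop)
  rw [stdGaussian_eq_conv_starProjection (ℝ ∙ h), Measure.conv, Measure.map_apply (by fun_prop) hB,
    Measure.prod_apply hadd]
  refine lintegral_eq_zero_of_ae_eq_zero (Eventually.of_forall fun g => ?_)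
  have hline : (ℝ ∙ h).starProjection ⁻¹' (Prod.mk g ⁻¹' ((fun x : E × E => x.1 + x.2) ⁻¹' B)) =
      innerSL ℝ h ⁻¹' ((· / ‖h‖ ^ 2) ⁻¹' {t | g + t • h ∈ B}) := by
    ext x
    simp [Submodule.starProjection_singleton]
  beta_reduce
  rw [Measure.map_apply (by fun_prop) (measurable_prodMk_left hadd), hline]
  refine stdGaussian_preimage_eq_zero_of_countable
    (fun h0 => hh (norm_eq_zero.1 (by rw [← innerSL_apply_norm ℝ h, h0, norm_zero])))
    ((hc g).preimage fun _ _ => (div_left_inj' (pow_ne_zero 2 (norm_ne_zero_iff.2 hh))).1)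

lemma map_stdGaussian_congr {E' G : Type*} [NormedAddCommGroup E'] [InnerProductSpace ℝ E']
    [FiniteDimensional ℝ E'] [MeasurableSpace E'] [BorelSpace E'] [NormedAddCommGroup G]
    [NormedSpace ℝ G] [CompleteSpace G] [SecondCountableTopology G] [MeasurableSpace G]
    [BorelSpace G] {S : E →L[ℝ] G} {S' : E' →L[ℝ] G}
    (h : ∀ L : StrongDual ℝ G, ‖L.comp S‖ = ‖L.comp S'‖) :
    (stdGaussian E).map S = (stdGaussian E').map S' := by
  have := Measure.isProbabilityMeasure_map (μ := stdGaussian E) S.continuous.aemeasurable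
  have := Measure.isProbabilityMeasure_map (μ := stdGaussian E') S'.continuous.aemeasurable
  refine Measure.ext_of_charFunDual (funext fun L => ?_)
  rw [charFunDual_map, charFunDual_map, charFunDual_stdGaussian, charFunDual_stdGaussian, h]

-- A planar model for the pair of functionals `⟪u, ·⟫`, `⟪v, ·⟫`: only the Gram matrix matters.
lemma map_stdGaussian_inner_inner_eq (u v : E) :
    (stdGaussian E).map (fun f => (⟪u, f⟫, ⟪v, f⟫)) =
      (stdGaussian ℂ).map fun z => (‖u‖ * z.im,
        ‖v‖ * (z.im * Real.cos (InnerProductGeometry.angle u v) -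
          z.re * Real.sin (InnerProductGeometry.angle u v))) := by
  set α := InnerProductGeometry.angle u v
  set u' : ℂ := ⟨0, ‖u‖⟩
  set v' : ℂ := ⟨-(‖v‖ * Real.sin α), ‖v‖ * Real.cos α⟩
  have gram_uv : ⟪u, v⟫ = ⟪u', v'⟫ := by
    rw [← InnerProductGeometry.cos_angle_mul_norm_mul_norm, Complex.inner]
    simp only [u', v', Complex.mul_re, Complex.conj_re, Complex.conj_im]
    ring
  have gram_uu : ‖u‖ ^ 2 = ‖u'‖ ^ 2 := by
    rw [← Complex.normSq_eq_norm_sq, Complex.normSq_mk]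
    ring
  have gram_vv : ‖v‖ ^ 2 = ‖v'‖ ^ 2 := by
    rw [← Complex.normSq_eq_norm_sq, Complex.normSq_mk]
    linear_combination -‖v‖ ^ 2 * Real.sin_sq_add_cos_sq α
  have hS' : (fun z : ℂ => (‖u‖ * z.im, ‖v‖ * (z.im * Real.cos α - z.re * Real.sin α))) =
      (innerSL ℝ u').prod (innerSL ℝ v') := by
    ext z <;> simp [Complex.inner, u', v'] <;> ring
  rw [hS']
  refine map_stdGaussian_congr (S := (innerSL ℝ u).prod (innerSL ℝ v)) fun L => ?_
  rw [dual_comp_innerSL_prod, dual_comp_innerSL_prod, innerSL_apply_norm, innerSL_apply_norm,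
    ← sq_eq_sq₀ (norm_nonneg _) (norm_nonneg _)]
  simp only [norm_add_sq_real, real_inner_smul_left, real_inner_smul_right, norm_smul, mul_pow,
    gram_uu, gram_vv, gram_uv]

lemma map_stdGaussian_complex_re_im :
    (stdGaussian ℂ).map (fun z => (z.re, z.im)) = (gaussianReal 0 1).prod (gaussianReal 0 1) := by
  rw [stdGaussian_eq_map_pi_orthonormalBasis Complex.orthonormalBasisOneI,
    Measure.map_map (by fun_prop) (by fun_prop),
    ← (measurePreserving_finTwoArrow (gaussianReal 0 1)).map_eq]
  congr 1
  ext x <;> simp [Fin.sum_univ_two, MeasurableEquiv.finTwoArrow]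

lemma gaussianPDF_mul_gaussianPDF_polar (r θ : ℝ) :
    gaussianPDF 0 1 (r * Real.cos θ) * gaussianPDF 0 1 (r * Real.sin θ) =
      ENNReal.ofReal ((2 * π)⁻¹ * Real.exp (-r ^ 2 / 2)) := by
  rw [gaussianPDF, gaussianPDF, ← ENNReal.ofReal_mul (gaussianPDFReal_nonneg _ _ _)]
  congr 1
  simp only [gaussianPDFReal, NNReal.coe_one, mul_one, sub_zero]
  rw [mul_mul_mul_comm, ← Real.exp_add, ← mul_inv, Real.mul_self_sqrt (by positivity)]
  congr 2
  linear_combination (-(r ^ 2) / 2) * Real.sin_sq_add_cos_sq θ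

lemma gaussianReal_prod_cone_eq_lintegral_mul {A : Set (ℝ × ℝ)} (hA : MeasurableSet A)
    {Θ : Set ℝ} (hΘ : MeasurableSet Θ)
    (h : ∀ r > 0, ∀ θ ∈ Set.Ioo (-π) π, (r * Real.cos θ, r * Real.sin θ) ∈ A ↔ θ ∈ Θ) :
    ((gaussianReal 0 1).prod (gaussianReal 0 1)) A =
      (∫⁻ r in Set.Ioi 0,
        ENNReal.ofReal r * ENNReal.ofReal ((2 * π)⁻¹ * Real.exp (-r ^ 2 / 2))) *
        volume (Θ ∩ Set.Ioo (-π) π) := by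
  rw [gaussianReal_of_var_ne_zero 0 one_ne_zero,
    prod_withDensity (measurable_gaussianPDF _ _) (measurable_gaussianPDF _ _),
    withDensity_apply _ hA, ← lintegral_indicator hA, ← Measure.volume_eq_prod,
    ← lintegral_comp_polarCoord_symm]
  have polar_integrand : ∀ p ∈ polarCoord.target, ENNReal.ofReal p.1 •
        A.indicator (fun z => gaussianPDF 0 1 z.1 * gaussianPDF 0 1 z.2) (polarCoord.symm p) =
      ENNReal.ofReal p.1 * ENNReal.ofReal ((2 * π)⁻¹ * Real.exp (-p.1 ^ 2 / 2)) *
        Θ.indicator 1 p.2 := by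
    rintro ⟨r, θ⟩ ⟨hr, hθ⟩
    have hiff := h r hr θ hθ
    rw [polarCoord_symm_apply, smul_eq_mul]
    by_cases hm : θ ∈ Θ
    · rw [Set.indicator_of_mem (hiff.2 hm), Set.indicator_of_mem hm,
        gaussianPDF_mul_gaussianPDF_polar, Pi.one_apply, mul_one]
    · rw [Set.indicator_of_notMem (mt hiff.1 hm), Set.indicator_of_notMem hm, mul_zero, mul_zero]
  rw [setLIntegral_congr_fun polarCoord.open_target.measurableSet polar_integrand,
    polarCoord_target, Measure.volume_eq_prod, ← Measure.prod_restrict,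
    lintegral_prod_mul (f := fun r => ENNReal.ofReal r *
      ENNReal.ofReal ((2 * π)⁻¹ * Real.exp (-r ^ 2 / 2))) (by fun_prop)
      (measurable_one.indicator hΘ).aemeasurable,
    lintegral_indicator_one hΘ, Measure.restrict_apply hΘ]

lemma gaussianReal_prod_cone {A : Set (ℝ × ℝ)} (hA : MeasurableSet A) {Θ : Set ℝ}
    (hΘ : MeasurableSet Θ)
    (h : ∀ r > 0, ∀ θ ∈ Set.Ioo (-π) π, (r * Real.cos θ, r * Real.sin θ) ∈ A ↔ θ ∈ Θ) :
    ((gaussianReal 0 1).prod (gaussianReal 0 1)) A =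
      volume (Θ ∩ Set.Ioo (-π) π) / ENNReal.ofReal (2 * π) := by
  have total := gaussianReal_prod_cone_eq_lintegral_mul .univ (Θ := Set.univ) .univ (by simp)
  rw [measure_univ, Set.univ_inter, Real.volume_Ioo, sub_neg_eq_add, ← two_mul] at total
  rw [gaussianReal_prod_cone_eq_lintegral_mul hA hΘ h,
    ENNReal.eq_inv_of_mul_eq_one_left total.symm, mul_comm, div_eq_mul_inv]

lemma sin_mul_sin_sub_neg_iff {α θ : ℝ} (hα : α ∈ Set.Icc 0 π) (hθ : θ ∈ Set.Ioo (-π) π) :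
    Real.sin θ * Real.sin (θ - α) < 0 ↔ θ ∈ Set.Ioo 0 α ∪ Set.Ioo (-π) (α - π) := by
  obtain ⟨hα0, hα1⟩ := hα
  obtain ⟨hθ0, hθ1⟩ := hθ
  have hs : Real.sin (θ - α) = -Real.sin (θ - α + π) := by rw [Real.sin_add_pi, neg_neg]
  simp only [Set.mem_union, Set.mem_Ioo]
  rcases lt_trichotomy θ 0 with h | rfl | h
  · rw [← smul_eq_mul, smul_neg_iff_of_neg_left (Real.sin_neg_of_neg_of_neg_pi_lt h hθ0), hs,
      neg_pos]
    rcases lt_or_ge θ (α - π) with h' | h'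
    · exact iff_of_true (Real.sin_neg_of_neg_of_neg_pi_lt (by linarith) (by linarith))
        (.inr ⟨hθ0, h'⟩)
    · exact iff_of_false
        (Real.sin_nonneg_of_nonneg_of_le_pi (by linarith) (by linarith)).not_gt
        (by rintro (h2 | h2) <;> linarith [h2.1, h2.2])
  · simp [hα1]
  · rw [← smul_eq_mul, smul_neg_iff_of_pos_left (Real.sin_pos_of_pos_of_lt_pi h hθ1)]
    rcases lt_or_ge θ α with h' | h'
    · exact iff_of_true (Real.sin_neg_of_neg_of_neg_pi_lt (by linarith) (by linarith))
        (.inl ⟨h, h'⟩)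
    · exact iff_of_false
        (Real.sin_nonneg_of_nonneg_of_le_pi (by linarith) (by linarith)).not_gt
        (by rintro (h2 | h2) <;> linarith [h2.1, h2.2])

lemma volume_opposite_sectors {α : ℝ} (hα : α ∈ Set.Icc 0 π) :
    volume ((Set.Ioo 0 α ∪ Set.Ioo (-π) (α - π)) ∩ Set.Ioo (-π) π) = ENNReal.ofReal (2 * α) := by
  obtain ⟨hα0, hα1⟩ := hα
  have hsub : Set.Ioo 0 α ∪ Set.Ioo (-π) (α - π) ⊆ Set.Ioo (-π) π := by
    rintro θ (h | h) <;> constructor <;> linarith [h.1, h.2]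
  have hdisj : Disjoint (Set.Ioo 0 α) (Set.Ioo (-π) (α - π)) :=
    Set.disjoint_left.2 fun θ h h' => by linarith [h.1, h'.2]
  rw [Set.inter_eq_left.2 hsub, measure_union hdisj measurableSet_Ioo, Real.volume_Ioo,
    Real.volume_Ioo, ← ENNReal.ofReal_add (by linarith) (by linarith)]
  congr 1
  ring

lemma stdGaussian_real_inner_mul_inner_neg {u v : E} (hu : u ≠ 0) (hv : v ≠ 0) :
    (stdGaussian E).real {f | ⟪u, f⟫ * ⟪v, f⟫ < 0} = InnerProductGeometry.angle u v / π := by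
  have hα : InnerProductGeometry.angle u v ∈ Set.Icc 0 π :=
    ⟨InnerProductGeometry.angle_nonneg _ _, InnerProductGeometry.angle_le_pi _ _⟩
  set α := InnerProductGeometry.angle u v
  have hS : MeasurableSet {p : ℝ × ℝ | p.1 * p.2 < 0} :=
    measurableSet_lt (by fun_prop) measurable_const
  let S' : ℝ × ℝ → ℝ × ℝ := fun p =>
    (‖u‖ * p.2, ‖v‖ * (p.2 * Real.cos α - p.1 * Real.sin α))
  have hS' : Measurable S' := by fun_prop
  have planar : stdGaussian E {f | ⟪u, f⟫ * ⟪v, f⟫ < 0} =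
      ((gaussianReal 0 1).prod (gaussianReal 0 1)) (S' ⁻¹' {p | p.1 * p.2 < 0}) := by
    rw [← map_stdGaussian_complex_re_im, Measure.map_apply (by fun_prop) (hS' hS)]
    have := congrArg (· {p : ℝ × ℝ | p.1 * p.2 < 0}) (map_stdGaussian_inner_inner_eq u v)
    rwa [Measure.map_apply (by fun_prop) hS, Measure.map_apply (by fun_prop) hS] at this
  have cone : ∀ r > 0, ∀ θ ∈ Set.Ioo (-π) π,
      (r * Real.cos θ, r * Real.sin θ) ∈ S' ⁻¹' {p | p.1 * p.2 < 0} ↔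
        θ ∈ Set.Ioo 0 α ∪ Set.Ioo (-π) (α - π) := by
    intro r hr θ hθ
    have hpos : 0 < ‖u‖ * ‖v‖ * r ^ 2 := by positivity
    rw [← sin_mul_sin_sub_neg_iff hα hθ, Real.sin_sub, ← smul_neg_iff_of_pos_left hpos,
      Set.mem_preimage, Set.mem_ofPred_eq, smul_eq_mul]
    simp only [S']
    ring_nf
  rw [measureReal_def, planar, gaussianReal_prod_cone (hS' hS)
      (measurableSet_Ioo.union measurableSet_Ioo) cone, volume_opposite_sectors hα,
    ← ENNReal.ofReal_div_of_pos (by positivity), mul_div_mul_left _ _ two_ne_zero,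
    ENNReal.toReal_ofReal (div_nonneg hα.1 Real.pi_pos.le)]

end Gaussian

section Pencil

open Polynomial

variable {K : Type*} [Field K] {g h : K[X]}

lemma exists_eq_C_mul_of_wronskian_eq_zero (hh : h.Separable) (hdeg : g.natDegree ≤ h.natDegree)
    (hW : wronskian g h = 0) : ∃ a, g = C a * h := by
  have hdvd : h ∣ g := IsCoprime.dvd_of_dvd_mul_right hh
    ⟨derivative g, by rw [sub_eq_zero.1 hW, mul_comm]⟩
  obtain ⟨c, rfl⟩ := hdvd
  by_cases hc : c = 0
  · exact ⟨0, by simp [hc]⟩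
  rw [natDegree_mul hh.ne_zero hc] at hdeg
  obtain ⟨a, rfl⟩ := natDegree_eq_zero.1 (show c.natDegree = 0 by omega)
  exact ⟨a, mul_comm _ _⟩

lemma not_separable_iff_exists_eval_eq_zero [IsAlgClosed K] {q : K[X]} :
    ¬ q.Separable ↔ ∃ z, q.eval z = 0 ∧ (derivative q).eval z = 0 := by
  rw [Separable, isCoprime_iff_aeval_ne_zero_of_isAlgClosed K K]
  push Not
  simp only [coe_aeval_eq_eval]

-- A multiple root of `g + t h` is a root of the Wronskian of `g` and `h`, and it determines `t`.
lemma finite_setOf_not_separable [IsAlgClosed K] (hh : h.Separable)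
    (hdeg : g.natDegree ≤ h.natDegree) : {t | ¬ (g + C t * h).Separable}.Finite := by
  by_cases hW : wronskian g h = 0
  · obtain ⟨a, rfl⟩ := exists_eq_C_mul_of_wronskian_eq_zero hh hdeg hW
    refine (Set.finite_singleton (-a)).subset fun t ht => ?_
    by_contra hta
    have hat : IsUnit (C (a + t)) := isUnit_C.2 (IsUnit.mk0 _ fun h0 => hta (by
      rw [Set.mem_singleton_iff]
      linear_combination h0))
    refine ht ?_
    rw [← add_mul, ← C_add]
    exact hh.unit_mul hat
  · have hfin := finite_setOfPred_isRoot hW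
    refine ((hfin.image fun z => -g.eval z / h.eval z).union
      (hfin.image fun z => -(derivative g).eval z / (derivative h).eval z)).subset fun t ht => ?_
    obtain ⟨z, hz, hz'⟩ := not_separable_iff_exists_eval_eq_zero.1 ht
    simp only [derivative_add, derivative_C_mul, eval_add, eval_mul, eval_C] at hz hz'
    have hWz : (wronskian g h).IsRoot z := by
      rw [IsRoot, wronskian, eval_sub, eval_mul, eval_mul]
      linear_combination (derivative h).eval z * hz - h.eval z * hz'
    by_cases h0 : h.eval z = 0
    · have h1 : (derivative h).eval z ≠ 0 := hh.eval₂_derivative_ne_zero (RingHom.id K) h0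
      refine .inr ⟨z, hWz, ?_⟩
      rw [div_eq_iff h1]
      linear_combination -hz'
    · refine .inl ⟨z, hWz, ?_⟩
      rw [div_eq_iff h0]
      linear_combination -hz

end Pencil

section Grid

open Finset

/-- The `j`-th point of the grid dividing `[0, T]` into `n` equal cells. -/
def gridPoint (T : ℝ) (n j : ℕ) : ℝ := T * j / n

/-- The index of the grid cell containing `x`. -/
def gridIndex (T : ℝ) (n : ℕ) (x : ℝ) : ℕ := ⌊x * n / T⌋₊

/-- The grid cells of `[0, T]` at whose endpoints `g` has opposite nonzero signs. Their number is
the discrete approximation of the number of zeros of `g`. -/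
def signChangeCells (g : ℝ → ℝ) (T : ℝ) (n : ℕ) : Finset ℕ :=
  {j ∈ range n | g (gridPoint T n j) * g (gridPoint T n (j + 1)) < 0}

/-- The zeros of `g` in one period `[0, T)`. -/
def zeros (g : ℝ → ℝ) (T : ℝ) : Set ℝ := {x ∈ Set.Ico 0 T | g x = 0}

variable {g : ℝ → ℝ} {T x θ : ℝ} {n : ℕ}

lemma gridPoint_succ (T : ℝ) (n j : ℕ) : gridPoint T n (j + 1) = gridPoint T n j + T / n := by
  simp only [gridPoint, Nat.cast_succ]
  ring

lemma monotone_gridPoint (hT : 0 ≤ T) : Monotone (gridPoint T n) := fun i j hij => by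
  unfold gridPoint
  gcongr

lemma gridPoint_mem_Icc (hT : 0 ≤ T) {j : ℕ} (hj : j ≤ n) : gridPoint T n j ∈ Set.Icc 0 T :=
  ⟨by unfold gridPoint; positivity, div_le_of_le_mul₀ n.cast_nonneg hT (by gcongr)⟩

lemma exists_zero_of_mul_neg (hg : Continuous g) {a b : ℝ} (hab : a ≤ b) (h : g a * g b < 0) :
    ∃ x ∈ Set.Ioo a b, g x = 0 := by
  rcases mul_neg_iff.1 h with ⟨ha, hb⟩ | ⟨ha, hb⟩
  · exact intermediate_value_Ioo' hab hg.continuousOn ⟨hb, ha⟩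
  · exact intermediate_value_Ioo hab hg.continuousOn ⟨ha, hb⟩

lemma card_signChangeCells_le (hT : 0 ≤ T) (hg : Continuous g) (hfin : (zeros g T).Finite) (n : ℕ) :
    #(signChangeCells g T n) ≤ (zeros g T).ncard := by
  have hzero : ∀ j ∈ signChangeCells g T n,
      ∃ x ∈ Set.Ioo (gridPoint T n j) (gridPoint T n (j + 1)), g x = 0 := fun j hj =>
    exists_zero_of_mul_neg hg (monotone_gridPoint hT j.le_succ) (mem_filter.1 hj).2
  choose! x hx hx0 using hzero
  rw [← Set.ncard_coe_finset]
  refine Set.ncard_le_ncard_of_injOn x (fun j hj => ⟨?_, hx0 j hj⟩) (fun i hi j hj hij => ?_) hfin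
  · have hjn : j < n := mem_range.1 (mem_filter.1 hj).1
    exact ⟨(gridPoint_mem_Icc hT hjn.le).1.trans (hx j hj).1.le,
      (hx j hj).2.trans_le (gridPoint_mem_Icc hT hjn).2⟩
  · by_contra hne
    exact Set.disjoint_left.1 ((monotone_gridPoint hT).pairwise_disjoint_on_Ioo_succ hne)
      (hx i hi) (hij ▸ hx j hj)

lemma gridPoint_gridIndex_le (hT : 0 < T) (hx : 0 ≤ x) : gridPoint T n (gridIndex T n x) ≤ x := by
  refine div_le_of_le_mul₀ n.cast_nonneg hx ?_
  rw [mul_comm, ← le_div_iff₀ hT]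
  exact Nat.floor_le (by positivity)

lemma lt_gridPoint_gridIndex_succ (hT : 0 < T) (hn : 0 < n) (x : ℝ) :
    x < gridPoint T n (gridIndex T n x + 1) := by
  rw [gridPoint, lt_div_iff₀ (by positivity), mul_comm T, ← div_lt_iff₀ hT]
  exact_mod_cast Nat.lt_floor_add_one (x * n / T)

lemma gridIndex_lt (hn : 0 < n) (hx : x ∈ Set.Ico 0 T) : gridIndex T n x < n := by
  have hT : 0 < T := hx.1.trans_lt hx.2
  rw [gridIndex, Nat.floor_lt (div_nonneg (mul_nonneg hx.1 n.cast_nonneg) hT.le), div_lt_iff₀ hT,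
    mul_comm]
  exact mul_lt_mul_of_pos_left hx.2 (by positivity)

lemma tendsto_gridPoint_gridIndex (hT : 0 < T) (hx : 0 ≤ x) :
    Tendsto (fun n => gridPoint T n (gridIndex T n x)) atTop (𝓝 x) := by
  have hlow : Tendsto (fun n : ℕ => x - T / n) atTop (𝓝 x) := by
    simpa using (tendsto_const_div_atTop_nhds_zero_nat T).const_sub x
  refine tendsto_of_tendsto_of_tendsto_of_le_of_le' hlow tendsto_const_nhds ?_
    (.of_forall fun n => gridPoint_gridIndex_le hT hx)
  filter_upwards [eventually_gt_atTop 0] with n hn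
  rw [sub_le_iff_le_add, ← gridPoint_succ]
  exact (lt_gridPoint_gridIndex_succ hT hn x).le

lemma eventually_mul_neg_of_deriv_ne_zero (hθ : g θ = 0) (hderiv : deriv g θ ≠ 0) :
    ∀ᶠ p in 𝓝[<] θ ×ˢ 𝓝[>] θ, g p.1 * g p.2 < 0 := by
  wlog hpos : 0 < deriv g θ generalizing g
  · simpa using this (g := -g) (by simpa) (by simpa [deriv.neg']) (by
      simpa [deriv.neg'] using hderiv.lt_of_le (not_lt.1 hpos))
  have hsign := eventually_nhdsWithin_sign_eq_of_deriv_pos hpos hθ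
  have hleft : ∀ᶠ x in 𝓝[<] θ, g x < 0 := by
    filter_upwards [hsign.filter_mono nhdsWithin_le_nhds, self_mem_nhdsWithin] with x hx hxθ
    rwa [← sign_eq_neg_one_iff, hx, sign_eq_neg_one_iff, sub_neg]
  have hright : ∀ᶠ x in 𝓝[>] θ, 0 < g x := by
    filter_upwards [hsign.filter_mono nhdsWithin_le_nhds, self_mem_nhdsWithin] with x hx hxθ
    rwa [← sign_eq_one_iff, hx, sign_eq_one_iff, sub_pos]
  exact (hleft.prod_mk hright).mono fun p hp => mul_neg_of_neg_of_pos hp.1 hp.2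

lemma eventually_gridIndex_mem_signChangeCells (hθ : θ ∈ zeros g T) (hderiv : deriv g θ ≠ 0)
    (hgrid : ∀ n j, g (gridPoint T n j) ≠ 0) :
    ∀ᶠ n in atTop, gridIndex T n θ ∈ signChangeCells g T n := by
  have hT : 0 < T := hθ.1.1.trans_lt hθ.1.2
  have hlim := tendsto_gridPoint_gridIndex hT hθ.1.1
  have hleft : Tendsto (fun n => gridPoint T n (gridIndex T n θ)) atTop (𝓝[<] θ) :=
    tendsto_nhdsWithin_iff.2 ⟨hlim, .of_forall fun n =>
      (gridPoint_gridIndex_le hT hθ.1.1).lt_of_ne fun h => hgrid n _ (h ▸ hθ.2)⟩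
  have hright : Tendsto (fun n => gridPoint T n (gridIndex T n θ + 1)) atTop (𝓝[>] θ) := by
    refine tendsto_nhdsWithin_iff.2 ⟨?_, (eventually_gt_atTop 0).mono fun n hn =>
      lt_gridPoint_gridIndex_succ hT hn θ⟩
    simpa only [gridPoint_succ, add_zero] using hlim.add (tendsto_const_div_atTop_nhds_zero_nat T)
  have hneg := (hleft.prodMk hright).eventually (eventually_mul_neg_of_deriv_ne_zero hθ.2 hderiv)
  filter_upwards [hneg, eventually_gt_atTop 0] with n hneg hn
  exact mem_filter.2 ⟨mem_range.2 (gridIndex_lt hn hθ.1), hneg⟩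

lemma eventually_injOn_gridIndex (hT : 0 < T) {s : Set ℝ} (hs : s.Finite) (hs0 : s ⊆ Set.Ici 0) :
    ∀ᶠ n in atTop, Set.InjOn (gridIndex T n) s := by
  refine (eventually_all_finite hs).2 fun x hx => (eventually_all_finite hs).2 fun y hy => ?_
  by_cases hxy : x = y
  · exact .of_forall fun n _ => hxy
  · have hlim := (tendsto_gridPoint_gridIndex hT (hs0 hx)).sub
      (tendsto_gridPoint_gridIndex hT (hs0 hy))
    exact (hlim.eventually_ne (sub_ne_zero.2 hxy)).mono fun n hne heq =>
      absurd (by rw [heq, sub_self]) hne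

lemma eventually_card_signChangeCells_eq (hT : 0 < T) (hg : Continuous g)
    (hfin : (zeros g T).Finite) (hsimple : ∀ θ ∈ zeros g T, deriv g θ ≠ 0)
    (hgrid : ∀ n j, g (gridPoint T n j) ≠ 0) :
    ∀ᶠ n in atTop, #(signChangeCells g T n) = (zeros g T).ncard := by
  have hmem : ∀ᶠ n in atTop, ∀ θ ∈ zeros g T, gridIndex T n θ ∈ signChangeCells g T n :=
    (eventually_all_finite hfin).2 fun θ hθ =>
      eventually_gridIndex_mem_signChangeCells hθ (hsimple θ hθ) hgrid
  filter_upwards [hmem, eventually_injOn_gridIndex hT hfin fun θ hθ => hθ.1.1] with n hmem hinj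
  refine (card_signChangeCells_le hT.le hg hfin n).antisymm ?_
  rw [← Set.ncard_coe_finset]
  exact Set.ncard_le_ncard_of_injOn _ hmem hinj

end Grid

section RandomFunction

open Finset

variable {Ω : Type*}

lemma card_signChangeCells_eq_sum_indicator (X : Ω → ℝ → ℝ) (T : ℝ) (n : ℕ) (ω : Ω) :
    (#(signChangeCells (X ω) T n) : ℝ) = ∑ j ∈ range n,
      {ω | X ω (gridPoint T n j) * X ω (gridPoint T n (j + 1)) < 0}.indicator
        (fun _ => 1) ω := by
  simp [signChangeCells, Set.indicator_apply]

variable [MeasurableSpace Ω] {μ : Measure Ω} {X : Ω → ℝ → ℝ} {T : ℝ}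

lemma measurableSet_mul_neg (hX : ∀ t, Measurable (X · t)) (s t : ℝ) :
    MeasurableSet {ω | X ω s * X ω t < 0} :=
  measurableSet_lt ((hX s).mul (hX t)) measurable_const

lemma measurable_card_signChangeCells (hX : ∀ t, Measurable (X · t)) (T : ℝ) (n : ℕ) :
    Measurable fun ω => (#(signChangeCells (X ω) T n) : ℝ) := by
  simp only [card_signChangeCells_eq_sum_indicator]
  exact measurable_fun_sum _ fun j _ => measurable_const.indicator (measurableSet_mul_neg hX _ _)

lemma integral_card_signChangeCells [IsFiniteMeasure μ] (hX : ∀ t, Measurable (X · t)) (T : ℝ)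
    (n : ℕ) : ∫ ω, (#(signChangeCells (X ω) T n) : ℝ) ∂μ =
      ∑ j ∈ range n, μ.real {ω | X ω (gridPoint T n j) * X ω (gridPoint T n (j + 1)) < 0} := by
  have hmeas := measurableSet_mul_neg hX
  simp only [card_signChangeCells_eq_sum_indicator]
  rw [integral_finsetSum _ fun j _ => (integrable_const (1 : ℝ)).indicator (hmeas _ _)]
  exact sum_congr rfl fun j _ => by
    rw [integral_indicator_const _ (hmeas _ _), smul_eq_mul, mul_one]

lemma ae_tendsto_card_signChangeCells (hT : 0 < T) (hcont : ∀ᵐ ω ∂μ, Continuous (X ω))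
    (hfin : ∀ᵐ ω ∂μ, (zeros (X ω) T).Finite)
    (hsimple : ∀ᵐ ω ∂μ, ∀ θ ∈ zeros (X ω) T, deriv (X ω) θ ≠ 0)
    (hne : ∀ t, ∀ᵐ ω ∂μ, X ω t ≠ 0) :
    ∀ᵐ ω ∂μ, Tendsto (fun n => (#(signChangeCells (X ω) T n) : ℝ)) atTop
      (𝓝 (zeros (X ω) T).ncard) := by
  have hgrid : ∀ᵐ ω ∂μ, ∀ n j, X ω (gridPoint T n j) ≠ 0 :=
    ae_all_iff.2 fun n => ae_all_iff.2 fun j => hne _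
  filter_upwards [hcont, hfin, hsimple, hgrid] with ω hcont hfin hsimple hgrid
  refine tendsto_const_nhds.congr' ?_
  filter_upwards [eventually_card_signChangeCells_eq hT hcont hfin hsimple hgrid] with n hn
  rw [hn]

lemma integrable_ncard_zeros [IsFiniteMeasure μ] (hX : ∀ t, Measurable (X · t)) {N : ℕ}
    (hle : ∀ᵐ ω ∂μ, (zeros (X ω) T).ncard ≤ N)
    (hlim : ∀ᵐ ω ∂μ, Tendsto (fun n => (#(signChangeCells (X ω) T n) : ℝ)) atTop
      (𝓝 (zeros (X ω) T).ncard)) :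
    Integrable (fun ω => ((zeros (X ω) T).ncard : ℝ)) μ := by
  refine .of_bound (aestronglyMeasurable_of_tendsto_ae atTop
    (fun n => (measurable_card_signChangeCells hX T n).aestronglyMeasurable) hlim) N ?_
  filter_upwards [hle] with ω hω
  simpa using hω

lemma tendsto_integral_card_signChangeCells [IsFiniteMeasure μ] (hT : 0 ≤ T)
    (hX : ∀ t, Measurable (X · t)) (hcont : ∀ᵐ ω ∂μ, Continuous (X ω))
    (hfin : ∀ᵐ ω ∂μ, (zeros (X ω) T).Finite)
    (hint : Integrable (fun ω => ((zeros (X ω) T).ncard : ℝ)) μ)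
    (hlim : ∀ᵐ ω ∂μ, Tendsto (fun n => (#(signChangeCells (X ω) T n) : ℝ)) atTop
      (𝓝 (zeros (X ω) T).ncard)) :
    Tendsto (fun n => ∫ ω, (#(signChangeCells (X ω) T n) : ℝ) ∂μ) atTop
      (𝓝 (∫ ω, ((zeros (X ω) T).ncard : ℝ) ∂μ)) := by
  refine tendsto_integral_of_dominated_convergence _
    (fun n => (measurable_card_signChangeCells hX T n).aestronglyMeasurable) hint (fun n => ?_) hlim
  filter_upwards [hcont, hfin] with ω hcont hfin
  simpa using card_signChangeCells_le hT hcont hfin n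

lemma integral_card_signChangeCells_inner {E : Type*} [NormedAddCommGroup E]
    [InnerProductSpace ℝ E] [FiniteDimensional ℝ E] [MeasurableSpace E] [BorelSpace E]
    {γ : ℝ → E} (hγ : ∀ t, γ t ≠ 0) (T : ℝ) (n : ℕ) :
    ∫ f, (#(signChangeCells (fun t => ⟪γ t, f⟫) T n) : ℝ) ∂(stdGaussian E) =
      ∑ j ∈ range n,
        InnerProductGeometry.angle (γ (gridPoint T n j)) (γ (gridPoint T n (j + 1))) / π := by
  rw [integral_card_signChangeCells fun t => by fun_prop]
  exact sum_congr rfl fun j _ => stdGaussian_real_inner_mul_inner_neg (hγ _) (hγ _)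

end RandomFunction

section RootMeanSquare

variable {ι α : Type*} {s : Finset ι}

/-- The root mean square `√((1 / #s) ∑_{i ∈ s} x_i²)`, in the form in which the expected number of
real roots is expressed. It is `0` for empty `s`. -/
def rms (s : Finset ι) (x : ι → ℝ) : ℝ := √((1 / (s.card : ℝ)) * ∑ i ∈ s, x i ^ 2)

lemma rms_const_mul (s : Finset ι) (c : ℝ) (x : ι → ℝ) :
    rms s (fun i => c * x i) = |c| * rms s x := by
  simp_rw [rms, mul_pow]
  rw [← Finset.mul_sum, mul_left_comm, Real.sqrt_mul (sq_nonneg c), Real.sqrt_sq_eq_abs]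

lemma tendsto_rms {l : Filter α} {x : α → ι → ℝ} {y : ι → ℝ}
    (h : ∀ i ∈ s, Tendsto (fun a => x a i) l (𝓝 (y i))) :
    Tendsto (fun a => rms s (x a)) l (𝓝 (rms s y)) :=
  ((tendsto_finsetSum _ fun i hi => (h i hi).pow 2).const_mul _).sqrt

lemma tendsto_natCast_mul_of_hasDerivAt {f : ℝ → ℝ} {f' L : ℝ} (hf : HasDerivAt f f' 0)
    (hf0 : f 0 = 0) {u : ℕ → ℝ} (hu : Tendsto (fun n => n * u n) atTop (𝓝 L)) :
    Tendsto (fun n => n * f (u n)) atTop (𝓝 (L * f')) := by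
  have hu0 : Tendsto u atTop (𝓝 0) := by
    have hdiv := hu.mul tendsto_inv_atTop_nhds_zero_nat
    rw [mul_zero] at hdiv
    refine hdiv.congr' ?_
    filter_upwards [eventually_ne_atTop 0] with n hn
    field_simp
  simpa [hf0] using hf.hasFDerivAt.hasFDerivWithinAt.lim (s := Set.univ)
    (c := fun n : ℕ => (n : ℝ)) hu0 (.of_forall fun _ => Set.mem_univ _) hu

lemma tendsto_natCast_mul_sin_div (a : ℝ) :
    Tendsto (fun n : ℕ => n * Real.sin (a / n)) atTop (𝓝 a) := by
  have hdiv : Tendsto (fun n : ℕ => n * (a / n)) atTop (𝓝 a) := by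
    refine tendsto_const_nhds.congr' ?_
    filter_upwards [eventually_ne_atTop 0] with n hn
    field_simp
  simpa using tendsto_natCast_mul_of_hasDerivAt (Real.hasDerivAt_sin 0) Real.sin_zero hdiv

lemma tendsto_natCast_mul_arcsin_rms_sin (s : Finset ι) (a : ι → ℝ) :
    Tendsto (fun n : ℕ => n * Real.arcsin (rms s fun i => Real.sin (a i / n))) atTop
      (𝓝 (rms s a)) := by
  have hrms : Tendsto (fun n : ℕ => n * rms s fun i => Real.sin (a i / n)) atTop
      (𝓝 (rms s a)) := by
    refine (tendsto_rms fun i _ => tendsto_natCast_mul_sin_div (a i)).congr fun n => ?_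
    rw [rms_const_mul, Nat.abs_cast]
  have harcsin : HasDerivAt Real.arcsin 1 0 := by
    simpa using Real.hasDerivAt_arcsin (x := 0) (by norm_num) (by norm_num)
  simpa using tendsto_natCast_mul_of_hasDerivAt harcsin Real.arcsin_zero hrms

end RootMeanSquare

section EvaluationVectors

variable {Λ : Finset ℤ}

lemma coeff_sum_C_mul_T (s : Finset ℤ) (c : ℤ → ℂ) (n : ℤ) :
    (∑ m ∈ s, LaurentPolynomial.C (c m) * LaurentPolynomial.T m).coeff n =
      if n ∈ s then c n else 0 := by
  simp only [← LaurentPolynomial.smul_eq_C_mul, AddMonoidAlgebra.coeff_sum, Finsupp.finsetSum_apply,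
    AddMonoidAlgebra.coeff_smul, Finsupp.smul_apply, LaurentPolynomial.T_apply, smul_eq_mul,
    mul_ite, mul_one, mul_zero, Finset.sum_ite_eq']

lemma eq_sum_C_coeff_mul_T {P : ℂ[T;T⁻¹]} (hP : ∀ m ∉ Λ, P.coeff m = 0) :
    P = ∑ m ∈ Λ, LaurentPolynomial.C (P.coeff m) * LaurentPolynomial.T m := by
  ext n
  rw [coeff_sum_C_mul_T, eq_comm, ite_eq_left_iff]
  exact fun hn => (hP n hn).symm

lemma value_sum_C_mul_T (s : Finset ℤ) (c : ℤ → ℂ) (z : ℂˣ) :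
    value (∑ m ∈ s, LaurentPolynomial.C (c m) * LaurentPolynomial.T m) z =
      ∑ m ∈ s, c m * (z : ℂ) ^ m := by
  simp [value, LaurentPolynomial.eval₂_C_mul_T]

lemma value_eq_sum (P : realLaurent Λ) (z : ℂˣ) :
    value P z = ∑ m ∈ Λ, (P : ℂ[T;T⁻¹]).coeff m * (z : ℂ) ^ m := by
  conv_lhs => rw [eq_sum_C_coeff_mul_T P.2.1, value_sum_C_mul_T]

/-- The real Laurent polynomial `∑_{m ∈ Λ} c_m z^m` with symmetric spectrum `Λ` and Hermitian
coefficients `c`. -/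
def ofCoeff (hsymm : ∀ l ∈ Λ, -l ∈ Λ) (c : ℤ → ℂ) (hc : ∀ m, c (-m) = conj (c m)) :
    realLaurent Λ where
  val := ∑ m ∈ Λ, LaurentPolynomial.C (c m) * LaurentPolynomial.T m
  property := by
    refine ⟨fun m hm => by rw [coeff_sum_C_mul_T, if_neg hm], fun z hz => ?_⟩
    have hconj : conj (z : ℂ) = (z : ℂ)⁻¹ := by
      rw [Complex.inv_def, Complex.normSq_eq_norm_sq, hz]
      simp
    rw [← Complex.conj_eq_iff_im, value_sum_C_mul_T, map_sum]
    refine Finset.sum_nbij' (fun m => -m) (fun m => -m) hsymm hsymm (by simp) (by simp) ?_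
    intro m _
    rw [map_mul, map_zpow₀, hconj, hc, inv_zpow, zpow_neg]

lemma coeff_ofCoeff (hsymm : ∀ l ∈ Λ, -l ∈ Λ) (c : ℤ → ℂ) (hc : ∀ m, c (-m) = conj (c m)) (n : ℤ) :
    (ofCoeff hsymm c hc : ℂ[T;T⁻¹]).coeff n = if n ∈ Λ then c n else 0 :=
  coeff_sum_C_mul_T Λ c n

lemma ofReal_trig (P : realLaurent Λ) (θ : ℝ) :
    (trig P θ : ℂ) = value P (Circle.toUnits (Circle.exp θ)) :=
  Complex.ext (by simp [trig]) (by simpa using (P.2.2 _ (by simp)).symm)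

lemma ofReal_trig_eq_sum (P : realLaurent Λ) (θ : ℝ) :
    (trig P θ : ℂ) =
      ∑ m ∈ Λ, (P : ℂ[T;T⁻¹]).coeff m * Complex.exp (m * Complex.I * θ) := by
  rw [ofReal_trig, value_eq_sum]
  refine Finset.sum_congr rfl fun m _ => ?_
  rw [Circle.toUnits_apply, Units.val_mk0, Circle.coe_exp, ← Complex.exp_int_mul]
  ring_nf

lemma integral_exp_int_mul (k : ℤ) :
    ∫ θ in (0 : ℝ)..(2 * π), Complex.exp (k * Complex.I * θ) =
      if k = 0 then 2 * (π : ℂ) else 0 := by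
  split_ifs with h
  · simp [h]
  · have hperiod : (k : ℂ) * Complex.I * ((2 * π : ℝ) : ℂ) = k * (2 * π * Complex.I) := by
      push_cast
      ring
    rw [integral_exp_mul_complex (mul_ne_zero (Int.cast_ne_zero.2 h) Complex.I_ne_zero), hperiod,
      Complex.exp_int_mul_two_pi_mul_I]
    simp

lemma ofReal_trig_mul_trig (P Q : realLaurent Λ) (θ : ℝ) :
    ((trig P θ * trig Q θ : ℝ) : ℂ) = ∑ m ∈ Λ, ∑ l ∈ Λ,
      ((P : ℂ[T;T⁻¹]).coeff l * (Q : ℂ[T;T⁻¹]).coeff m) *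
        Complex.exp ((l + m : ℤ) * Complex.I * θ) := by
  rw [Complex.ofReal_mul, ofReal_trig_eq_sum, ofReal_trig_eq_sum, Finset.sum_mul_sum,
    Finset.sum_comm]
  refine Finset.sum_congr rfl fun m _ => Finset.sum_congr rfl fun l _ => ?_
  rw [mul_mul_mul_comm, ← Complex.exp_add]
  push_cast
  ring_nf

lemma integral_trig_mul_trig (P Q : realLaurent Λ) :
    ((∫ θ in (0 : ℝ)..(2 * π), trig P θ * trig Q θ : ℝ) : ℂ) =
      2 * π * ∑ m ∈ Λ, (P : ℂ[T;T⁻¹]).coeff (-m) * (Q : ℂ[T;T⁻¹]).coeff m := by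
  rw [← intervalIntegral.integral_ofReal]
  simp_rw [ofReal_trig_mul_trig]
  rw [intervalIntegral.integral_finsetSum fun m _ =>
    Continuous.intervalIntegrable (by fun_prop) _ _, Finset.mul_sum]
  refine Finset.sum_congr rfl fun m _ => ?_
  rw [intervalIntegral.integral_finsetSum fun l _ =>
    Continuous.intervalIntegrable (by fun_prop) _ _]
  simp_rw [intervalIntegral.integral_const_mul, integral_exp_int_mul, ← eq_neg_iff_add_eq_zero,
    mul_ite, mul_zero, Finset.sum_ite_eq']
  split_ifs with hm
  · ring
  · rw [P.2.1 _ hm, zero_mul, mul_zero]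

lemma ofReal_inner_eq_sum (P Q : realLaurent Λ) :
    ((⟪P, Q⟫ : ℝ) : ℂ) = ∑ m ∈ Λ, (P : ℂ[T;T⁻¹]).coeff (-m) * (Q : ℂ[T;T⁻¹]).coeff m := by
  have hdef : ⟪P, Q⟫ = (1 / (2 * π)) * ∫ θ in (0 : ℝ)..(2 * π), trig P θ * trig Q θ := rfl
  have hπ : (π : ℂ) ≠ 0 := Complex.ofReal_ne_zero.2 Real.pi_ne_zero
  rw [hdef, Complex.ofReal_mul, integral_trig_mul_trig]
  push_cast
  field_simp

/-- The vector of `realLaurent Λ` representing the evaluation `P ↦ P(e^{it})`, i.e. the reproducing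
kernel `∑_{m ∈ Λ} e^{-imt} z^m`. -/
def evalVec (hsymm : ∀ l ∈ Λ, -l ∈ Λ) (t : ℝ) : realLaurent Λ :=
  ofCoeff hsymm (fun m => Complex.exp (-(m * Complex.I * t))) fun m => by
    rw [← Complex.exp_conj]
    simp

lemma inner_evalVec (hsymm : ∀ l ∈ Λ, -l ∈ Λ) (t : ℝ) (P : realLaurent Λ) :
    ⟪evalVec hsymm t, P⟫ = trig P t := by
  apply Complex.ofReal_injective
  rw [ofReal_inner_eq_sum, ofReal_trig_eq_sum]
  refine Finset.sum_congr rfl fun m hm => ?_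
  rw [evalVec, coeff_ofCoeff, if_pos (hsymm m hm), mul_comm]
  simp

lemma inner_evalVec_evalVec (hsymm : ∀ l ∈ Λ, -l ∈ Λ) (s t : ℝ) :
    ⟪evalVec hsymm s, evalVec hsymm t⟫ = ∑ m ∈ Λ, Real.cos (m * (s - t)) := by
  rw [inner_evalVec, ← Complex.ofReal_re (trig _ _), ofReal_trig_eq_sum, Complex.re_sum]
  refine Finset.sum_congr rfl fun m hm => ?_
  rw [evalVec, coeff_ofCoeff, if_pos hm, ← Complex.exp_add, ← Complex.exp_ofReal_mul_I_re]
  congr 2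
  push_cast
  ring

lemma norm_evalVec (hsymm : ∀ l ∈ Λ, -l ∈ Λ) (t : ℝ) : ‖evalVec hsymm t‖ = √(Λ.card : ℝ) := by
  rw [norm_eq_sqrt_real_inner, inner_evalVec_evalVec]
  simp

lemma evalVec_ne_zero (hsymm : ∀ l ∈ Λ, -l ∈ Λ) (hne : Λ.Nonempty) (t : ℝ) :
    evalVec hsymm t ≠ 0 := by
  rw [← norm_pos_iff, norm_evalVec]
  exact Real.sqrt_pos.2 (by exact_mod_cast hne.card_pos)

lemma norm_evalVec_sub_evalVec_sq (hsymm : ∀ l ∈ Λ, -l ∈ Λ) (s t : ℝ) :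
    ‖evalVec hsymm s - evalVec hsymm t‖ ^ 2 = 2 ^ 2 * ∑ m ∈ Λ, Real.sin (m * (s - t) / 2) ^ 2 := by
  have hcos : ∀ m ∈ Λ, Real.cos (m * (s - t)) = 1 - 2 * Real.sin (m * (s - t) / 2) ^ 2 := by
    intro m _
    rw [← Real.cos_two_mul_eq_one_sub, mul_div_cancel₀ _ two_ne_zero]
  rw [norm_sub_sq_real, norm_evalVec, norm_evalVec, Real.sq_sqrt (Nat.cast_nonneg _),
    inner_evalVec_evalVec, Finset.sum_congr rfl hcos, Finset.sum_sub_distrib, ← Finset.mul_sum]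
  simp only [Finset.sum_const, nsmul_eq_mul, mul_one]
  ring

lemma angle_evalVec (hsymm : ∀ l ∈ Λ, -l ∈ Λ) (hne : Λ.Nonempty) (s t : ℝ) :
    InnerProductGeometry.angle (evalVec hsymm s) (evalVec hsymm t) =
      2 * Real.arcsin (rms Λ fun m => Real.sin (m * (s - t) / 2)) := by
  rw [angle_eq_two_mul_arcsin (evalVec_ne_zero hsymm hne s) (by rw [norm_evalVec, norm_evalVec]),
    ← Real.sqrt_sq (norm_nonneg (_ - _)), norm_evalVec_sub_evalVec_sq, norm_evalVec,
    Real.sqrt_mul (by positivity), Real.sqrt_sq zero_le_two, mul_div_mul_left _ _ two_ne_zero,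
    ← Real.sqrt_div' _ (Nat.cast_nonneg _), rms, one_div_mul_eq_div]

lemma integral_card_signChangeCells_trig (hsymm : ∀ l ∈ Λ, -l ∈ Λ) (hne : Λ.Nonempty) (n : ℕ) :
    ∫ P : realLaurent Λ, ((signChangeCells (trig P) (2 * π) n).card : ℝ) ∂(law Λ) =
      2 / π * (n * Real.arcsin (rms Λ fun m => Real.sin (m * π / n))) := by
  have hcell : ∀ j, InnerProductGeometry.angle (evalVec hsymm (gridPoint (2 * π) n j))
      (evalVec hsymm (gridPoint (2 * π) n (j + 1))) =
        2 * Real.arcsin (rms Λ fun m => Real.sin (m * π / n)) := by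
    intro j
    rw [InnerProductGeometry.angle_comm, angle_evalVec hsymm hne, gridPoint_succ]
    congr! 4 with m
    ring_nf
  have hsum := integral_card_signChangeCells_inner (evalVec_ne_zero hsymm hne) (2 * π) n
  simp_rw [inner_evalVec, hcell] at hsum
  rw [law, hsum, Finset.sum_const, Finset.card_range, nsmul_eq_mul]
  ring

lemma tendsto_integral_card_signChangeCells_trig (hsymm : ∀ l ∈ Λ, -l ∈ Λ) (hne : Λ.Nonempty) :
    Tendsto (fun n => ∫ P : realLaurent Λ, ((signChangeCells (trig P) (2 * π) n).card : ℝ) ∂(law Λ))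
      atTop (𝓝 (2 * rms Λ fun m => (m : ℝ))) := by
  simp_rw [integral_card_signChangeCells_trig hsymm hne]
  have hlim := (tendsto_natCast_mul_arcsin_rms_sin Λ fun m => m * π).const_mul (2 / π)
  simp_rw [mul_comm _ π] at hlim ⊢
  rw [rms_const_mul, abs_of_pos Real.pi_pos, ← mul_assoc, div_mul_cancel₀ _ Real.pi_ne_zero] at hlim
  exact hlim

end EvaluationVectors

section AssociatedPolynomial

open Polynomial

variable {Λ : Finset ℤ}

lemma natAbs_le_degree {m : ℤ} (hm : m ∈ Λ) : m.natAbs ≤ degree Λ :=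
  Finset.le_sup (f := Int.natAbs) hm

lemma mem_of_natAbs_eq_degree (hsymm : ∀ l ∈ Λ, -l ∈ Λ) (hne : Λ.Nonempty) {m : ℤ}
    (hm : m.natAbs = degree Λ) : m ∈ Λ := by
  obtain ⟨l, hl, hdeg⟩ := Finset.exists_mem_eq_sup Λ hne Int.natAbs
  rcases Int.natAbs_eq_natAbs_iff.1 (hm.trans hdeg) with rfl | rfl
  · exact hl
  · exact hsymm l hl

/-- The polynomial `z^d P(z)`, where `d` is the degree of the spectrum. The exponents `m + d` are
nonnegative for `m ∈ Λ`, so `toNat` does not truncate. -/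
def poly (P : realLaurent Λ) : ℂ[X] :=
  ∑ m ∈ Λ, C ((P : ℂ[T;T⁻¹]).coeff m) * X ^ (m + degree Λ).toNat

lemma coeff_poly (P : realLaurent Λ) (n : ℕ) :
    (poly P).coeff n = (P : ℂ[T;T⁻¹]).coeff (n - degree Λ) := by
  have hexp : ∀ m ∈ Λ, (if n = (m + degree Λ).toNat then (P : ℂ[T;T⁻¹]).coeff m else 0) =
      if m = (n : ℤ) - degree Λ then (P : ℂ[T;T⁻¹]).coeff m else 0 := by
    intro m hm
    have := natAbs_le_degree hm
    refine if_congr ?_ rfl rfl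
    omega
  simp only [poly, finsetSum_coeff, coeff_C_mul_X_pow]
  rw [Finset.sum_congr rfl hexp, Finset.sum_ite_eq', ite_eq_left_iff]
  exact fun hn => (P.2.1 _ hn).symm

lemma poly_add_smul (P Q : realLaurent Λ) (t : ℝ) :
    poly (P + t • Q) = poly P + C (t : ℂ) * poly Q := by
  ext n
  simp [coeff_poly]

lemma natDegree_poly_le (P : realLaurent Λ) : (poly P).natDegree ≤ 2 * degree Λ := by
  refine natDegree_le_iff_coeff_eq_zero.2 fun n hn => ?_
  rw [coeff_poly]
  refine P.2.1 _ fun hmem => ?_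
  have := natAbs_le_degree hmem
  omega

lemma natDegree_poly {P : realLaurent Λ} (hP : (P : ℂ[T;T⁻¹]).coeff (degree Λ) ≠ 0) :
    (poly P).natDegree = 2 * degree Λ := by
  refine (natDegree_poly_le P).antisymm (le_natDegree_of_ne_zero ?_)
  rwa [coeff_poly, Nat.cast_mul, Nat.cast_two, two_mul, add_sub_cancel_right]

lemma eval_poly (P : realLaurent Λ) (z : ℂˣ) :
    (poly P).eval (z : ℂ) = (z : ℂ) ^ degree Λ * value P z := by
  rw [value_eq_sum, poly, eval_finsetSum, Finset.mul_sum]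
  refine Finset.sum_congr rfl fun m hm => ?_
  have := natAbs_le_degree hm
  rw [eval_mul, eval_C, eval_pow, eval_X, ← zpow_natCast, ← zpow_natCast,
    Int.toNat_of_nonneg (by omega), zpow_add₀ z.ne_zero]
  ring

lemma isRoot_poly_iff {P : realLaurent Λ} {z : ℂˣ} :
    (poly P).IsRoot z ↔ z ∈ roots (P : ℂ[T;T⁻¹]) := by
  rw [IsRoot, eval_poly, mul_eq_zero, or_iff_right (pow_ne_zero _ z.ne_zero)]
  rfl

lemma image_val_roots {P : realLaurent Λ} (h0 : poly P ≠ 0)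
    (hlow : (P : ℂ[T;T⁻¹]).coeff (-degree Λ) ≠ 0) :
    Units.val '' roots (P : ℂ[T;T⁻¹]) = (poly P).rootSet ℂ := by
  ext z
  rw [mem_rootSet_of_ne h0, coe_aeval_eq_eval]
  constructor
  · rintro ⟨w, hw, rfl⟩
    exact isRoot_poly_iff.2 hw
  · intro hz
    have hz0 : z ≠ 0 := by
      rintro rfl
      rw [← coeff_zero_eq_eval_zero, coeff_poly] at hz
      exact hlow (by simpa using hz)
    exact ⟨Units.mk0 z hz0, isRoot_poly_iff.1 hz, rfl⟩

lemma finite_roots {P : realLaurent Λ} (hsep : (poly P).Separable) :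
    (roots (P : ℂ[T;T⁻¹])).Finite := by
  refine .of_finite_image ?_ Units.val_injective.injOn
  refine ((poly P).rootSet_finite ℂ).subset ?_
  rintro _ ⟨z, hz, rfl⟩
  rw [mem_rootSet_of_ne hsep.ne_zero, coe_aeval_eq_eval]
  exact isRoot_poly_iff.2 hz

lemma ncard_roots {P : realLaurent Λ} (hsep : (poly P).Separable)
    (htop : (P : ℂ[T;T⁻¹]).coeff (degree Λ) ≠ 0) (hlow : (P : ℂ[T;T⁻¹]).coeff (-degree Λ) ≠ 0) :
    (roots (P : ℂ[T;T⁻¹])).ncard = 2 * degree Λ := by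
  rw [← Set.ncard_image_of_injective _ Units.val_injective, image_val_roots hsep.ne_zero hlow,
    ← Nat.card_coe_set_eq, Nat.card_eq_fintype_card,
    card_rootSet_eq_natDegree hsep (IsAlgClosed.splits _), natDegree_poly htop]

lemma differentiable_trig (P : realLaurent Λ) : Differentiable ℝ (trig P) := by
  have htrig : trig P = fun θ : ℝ =>
      (∑ m ∈ Λ, (P : ℂ[T;T⁻¹]).coeff m * Complex.exp (m * Complex.I * θ)).re :=
    funext fun θ => by rw [← ofReal_trig_eq_sum, Complex.ofReal_re]
  have : Differentiable ℝ Complex.ofReal := Complex.ofRealCLM.differentiable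
  rw [htrig]
  exact Complex.reCLM.differentiable.comp (by fun_prop)

lemma eval_poly_circleMap (P : realLaurent Λ) (θ : ℝ) :
    (poly P).eval (circleMap 0 1 θ) = circleMap 0 1 θ ^ degree Λ * trig P θ := by
  have heval := eval_poly P (Circle.toUnits (Circle.exp θ))
  rw [← ofReal_trig, Circle.toUnits_apply, Units.val_mk0, Circle.coe_exp] at heval
  simpa [circleMap] using heval

-- Differentiate `poly P (e^{iθ}) = e^{idθ} P(e^{iθ})`.
lemma deriv_trig_ne_zero {P : realLaurent Λ} (hsep : (poly P).Separable) {θ : ℝ}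
    (hθ : trig P θ = 0) : deriv (trig P) θ ≠ 0 := by
  intro hderiv
  have hroot : (poly P).eval (circleMap 0 1 θ) = 0 := by
    rw [eval_poly_circleMap, hθ, Complex.ofReal_zero, mul_zero]
  have hleft : HasDerivAt (fun x : ℝ => (poly P).eval (circleMap 0 1 x))
      ((derivative (poly P)).eval (circleMap 0 1 θ) * (circleMap 0 1 θ * Complex.I)) θ :=
    ((poly P).hasDerivAt _).comp θ (hasDerivAt_circleMap 0 1 θ)
  have hright := ((hasDerivAt_circleMap 0 1 θ).pow (degree Λ)).mul
    (differentiable_trig P θ).hasDerivAt.ofReal_comp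
  rw [hderiv, hθ, Complex.ofReal_zero, mul_zero, mul_zero, add_zero] at hright
  simp_rw [eval_poly_circleMap] at hleft
  have hzero := hleft.unique hright
  refine hsep.eval₂_derivative_ne_zero (RingHom.id ℂ) hroot ?_
  exact (mul_eq_zero.1 hzero).resolve_right
    (mul_ne_zero (circleMap_ne_center one_ne_zero) Complex.I_ne_zero)

lemma bijOn_zeros_realRoots (P : realLaurent Λ) :
    Set.BijOn (fun θ : ℝ => Circle.toUnits (Circle.exp θ)) (zeros (trig P) (2 * π))
      (realRoots (P : ℂ[T;T⁻¹])) := by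
  refine ⟨fun θ hθ => ⟨?_, by simp⟩, fun x hx y hy hxy => ?_, fun z hz => ?_⟩
  · change value _ _ = 0
    rw [← ofReal_trig, hθ.2, Complex.ofReal_zero]
  · exact Circle.exp_injOn_Ico (sub_zero _).le hx.1 hy.1 (Subtype.ext (congrArg Units.val hxy))
  · let w : Circle := ⟨z, mem_sphere_zero_iff_norm.2 hz.2⟩
    have hexp : Circle.toUnits (Circle.exp (toIcoMod Real.two_pi_pos 0 (Complex.arg w))) = z := by
      rw [toIcoMod, Circle.periodic_exp.sub_zsmul_eq, Circle.exp_arg]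
      exact Units.ext rfl
    have hroot : value P z = 0 := hz.1
    refine ⟨toIcoMod Real.two_pi_pos 0 (Complex.arg w), ⟨?_, ?_⟩, hexp⟩
    · simpa using toIcoMod_mem_Ico Real.two_pi_pos 0 (Complex.arg w)
    · rw [trig, hexp, hroot, Complex.zero_re]

lemma ncard_realRoots (P : realLaurent Λ) :
    (realRoots (P : ℂ[T;T⁻¹])).ncard = (zeros (trig P) (2 * π)).ncard := by
  rw [← (bijOn_zeros_realRoots P).image_eq, (bijOn_zeros_realRoots P).injOn.ncard_image]

lemma realRoots_subset_roots (P : ℂ[T;T⁻¹]) : realRoots P ⊆ roots P := fun _ hz => hz.1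

lemma finite_zeros_trig {P : realLaurent Λ} (hsep : (poly P).Separable) :
    (zeros (trig P) (2 * π)).Finite :=
  (bijOn_zeros_realRoots P).finite_iff_finite.2
    ((finite_roots hsep).subset (realRoots_subset_roots _))

lemma ncard_zeros_trig_le {P : realLaurent Λ} (hsep : (poly P).Separable) :
    (zeros (trig P) (2 * π)).ncard ≤ (roots (P : ℂ[T;T⁻¹])).ncard := by
  rw [← ncard_realRoots]
  exact Set.ncard_le_ncard (realRoots_subset_roots _) (finite_roots hsep)

end AssociatedPolynomial

section GenericSimplicity

open Polynomial

lemma measurableSet_image_of_isClosed {X Y : Type*} [TopologicalSpace X] [SigmaCompactSpace X]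
    [TopologicalSpace Y] [T2Space Y] [MeasurableSpace Y] [OpensMeasurableSpace Y] {f : X → Y}
    (hf : Continuous f) {s : Set X} (hs : IsClosed s) : MeasurableSet (f '' s) := by
  obtain ⟨K, hK, hKs⟩ := (isSigmaCompact_univ.of_isClosed_subset hs (Set.subset_univ s)).image hf
  rw [← hKs]
  exact .iUnion fun n => (hK n).measurableSet

variable {Λ : Finset ℤ}

/-- The real Laurent polynomial `z^d + z^{-d}`, where `d` is the degree of the spectrum, or `1` if
`d = 0`. Along lines in this direction all but finitely many Laurent polynomials have only simple
roots. -/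
def extremal (hsymm : ∀ l ∈ Λ, -l ∈ Λ) : realLaurent Λ :=
  ofCoeff hsymm (fun m => if m.natAbs = degree Λ then 1 else 0) fun m => by
    rw [Int.natAbs_neg, apply_ite conj, map_one, map_zero]

lemma coeff_extremal (hsymm : ∀ l ∈ Λ, -l ∈ Λ) (hne : Λ.Nonempty) (m : ℤ) :
    (extremal hsymm : ℂ[T;T⁻¹]).coeff m = if m.natAbs = degree Λ then 1 else 0 := by
  rw [extremal, coeff_ofCoeff, ite_eq_left_iff]
  exact fun hm => (if_neg fun hdeg => hm (mem_of_natAbs_eq_degree hsymm hne hdeg)).symm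

lemma coeff_extremal_of_natAbs_eq (hsymm : ∀ l ∈ Λ, -l ∈ Λ) (hne : Λ.Nonempty) {m : ℤ}
    (hm : m.natAbs = degree Λ) : (extremal hsymm : ℂ[T;T⁻¹]).coeff m = 1 := by
  rw [coeff_extremal hsymm hne, if_pos hm]

lemma extremal_ne_zero (hsymm : ∀ l ∈ Λ, -l ∈ Λ) (hne : Λ.Nonempty) : extremal hsymm ≠ 0 := by
  intro h
  have hcoeff := coeff_extremal_of_natAbs_eq hsymm hne (Int.natAbs_natCast _)
  simp [h] at hcoeff

lemma poly_extremal_of_degree_eq_zero (hsymm : ∀ l ∈ Λ, -l ∈ Λ) (hne : Λ.Nonempty)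
    (hd : degree Λ = 0) : poly (extremal hsymm) = 1 := by
  ext n
  rw [coeff_poly, coeff_extremal hsymm hne, hd, coeff_one]
  refine if_congr ?_ rfl rfl
  omega

lemma poly_extremal_of_degree_ne_zero (hsymm : ∀ l ∈ Λ, -l ∈ Λ) (hne : Λ.Nonempty)
    (hd : degree Λ ≠ 0) : poly (extremal hsymm) = X ^ (2 * degree Λ) - C (-1) := by
  ext n
  have hexp : ((n : ℤ) - degree Λ).natAbs = degree Λ ↔ n = 2 * degree Λ ∨ n = 0 := by omega
  rw [coeff_poly, coeff_extremal hsymm hne, coeff_sub, coeff_X_pow, coeff_C]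
  grind

lemma separable_poly_extremal (hsymm : ∀ l ∈ Λ, -l ∈ Λ) (hne : Λ.Nonempty) :
    (poly (extremal hsymm)).Separable := by
  by_cases hd : degree Λ = 0
  · rw [poly_extremal_of_degree_eq_zero hsymm hne hd]
    exact separable_one
  · rw [poly_extremal_of_degree_ne_zero hsymm hne hd]
    exact separable_X_pow_sub_C _ (Nat.cast_ne_zero.2 (mul_ne_zero two_ne_zero hd))
      (neg_ne_zero.2 one_ne_zero)

lemma natDegree_poly_extremal (hsymm : ∀ l ∈ Λ, -l ∈ Λ) (hne : Λ.Nonempty) :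
    (poly (extremal hsymm)).natDegree = 2 * degree Λ := by
  refine natDegree_poly ?_
  rw [coeff_extremal_of_natAbs_eq hsymm hne (Int.natAbs_natCast _)]
  exact one_ne_zero

lemma continuous_coeff (m : ℤ) :
    Continuous fun P : realLaurent Λ => (P : ℂ[T;T⁻¹]).coeff m := by
  let coeffLinear : realLaurent Λ →ₗ[ℝ] ℂ :=
    { toFun := fun P => (P : ℂ[T;T⁻¹]).coeff m
      map_add' := fun P Q => by simp
      map_smul' := fun c P => by simp }
  exact coeffLinear.continuous_of_finiteDimensional

lemma continuous_eval_poly :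
    Continuous fun p : realLaurent Λ × ℂ => (poly p.1).eval p.2 := by
  simp only [poly, eval_finsetSum, eval_mul, eval_C, eval_pow, eval_X]
  exact continuous_finsetSum _ fun m _ =>
    ((continuous_coeff m).comp continuous_fst).mul (continuous_snd.pow _)

lemma continuous_eval_derivative_poly :
    Continuous fun p : realLaurent Λ × ℂ => (derivative (poly p.1)).eval p.2 := by
  simp only [poly, derivative_sum, derivative_C_mul_X_pow, eval_finsetSum, eval_mul, eval_C,
    eval_pow, eval_X]
  exact continuous_finsetSum _ fun m _ =>
    (((continuous_coeff m).comp continuous_fst).mul continuous_const).mul (continuous_snd.pow _)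

lemma measurableSet_not_separable_poly :
    MeasurableSet {P : realLaurent Λ | ¬ (poly P).Separable} := by
  have : ProperSpace (realLaurent Λ) := FiniteDimensional.proper_real _
  have hclosed : IsClosed {p : realLaurent Λ × ℂ |
      (poly p.1).eval p.2 = 0 ∧ (derivative (poly p.1)).eval p.2 = 0} :=
    (isClosed_singleton.preimage continuous_eval_poly).inter
      (isClosed_singleton.preimage continuous_eval_derivative_poly)
  convert measurableSet_image_of_isClosed continuous_fst hclosed using 1
  ext P
  simp [not_separable_iff_exists_eval_eq_zero]

lemma ae_separable_poly (hsymm : ∀ l ∈ Λ, -l ∈ Λ) (hne : Λ.Nonempty) :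
    ∀ᵐ P ∂law Λ, (poly P).Separable := by
  refine stdGaussian_eq_zero_of_countable_lines measurableSet_not_separable_poly
    (extremal_ne_zero hsymm hne) fun P => ?_
  have hfinite := finite_setOf_not_separable (separable_poly_extremal hsymm hne)
    ((natDegree_poly_le P).trans_eq (natDegree_poly_extremal hsymm hne).symm)
  refine (hfinite.preimage Complex.ofReal_injective.injOn).countable.mono fun t ht => ?_
  change ¬ _
  rw [← poly_add_smul]
  exact ht

lemma ae_coeff_ne_zero (hsymm : ∀ l ∈ Λ, -l ∈ Λ) (hne : Λ.Nonempty) {m : ℤ}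
    (hm : m.natAbs = degree Λ) : ∀ᵐ P : realLaurent Λ ∂law Λ, (P : ℂ[T;T⁻¹]).coeff m ≠ 0 := by
  have hmeas : MeasurableSet {P : realLaurent Λ | ¬ (P : ℂ[T;T⁻¹]).coeff m ≠ 0} := by
    simp only [not_not]
    exact (isClosed_singleton.preimage (continuous_coeff m)).measurableSet
  refine stdGaussian_eq_zero_of_countable_lines hmeas (extremal_ne_zero hsymm hne) fun P =>
    Set.Subsingleton.countable fun s hs t ht => ?_
  have hline : ∀ u : ℝ, ¬ (P + u • extremal hsymm : ℂ[T;T⁻¹]).coeff m ≠ 0 →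
      (u : ℂ) = -(P : ℂ[T;T⁻¹]).coeff m := fun u hu =>
    eq_neg_of_add_eq_zero_right (by simpa [coeff_extremal_of_natAbs_eq hsymm hne hm] using hu)
  exact Complex.ofReal_injective ((hline s hs).trans (hline t ht).symm)

lemma ae_ncard_roots (hsymm : ∀ l ∈ Λ, -l ∈ Λ) (hne : Λ.Nonempty) :
    ∀ᵐ P : realLaurent Λ ∂law Λ, (roots (P : ℂ[T;T⁻¹])).ncard = 2 * degree Λ := by
  filter_upwards [ae_separable_poly hsymm hne,
    ae_coeff_ne_zero hsymm hne (Int.natAbs_natCast (degree Λ)),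
    ae_coeff_ne_zero hsymm hne ((Int.natAbs_neg _).trans (Int.natAbs_natCast (degree Λ)))]
    with P hsep htop hlow
  exact ncard_roots hsep htop hlow

lemma ae_trig_ne_zero (hsymm : ∀ l ∈ Λ, -l ∈ Λ) (hne : Λ.Nonempty) (t : ℝ) :
    ∀ᵐ P ∂law Λ, trig P t ≠ 0 := by
  have hL : innerSL ℝ (evalVec hsymm t) ≠ 0 := fun h =>
    evalVec_ne_zero hsymm hne t (norm_eq_zero.1 (by rw [← innerSL_apply_norm ℝ, h, norm_zero]))
  convert stdGaussian_preimage_eq_zero_of_countable hL (Set.countable_singleton 0) using 1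
  simp [ae_iff, law, Set.preimage, inner_evalVec]

end GenericSimplicity

section ExpectedRealRoots

variable {Λ : Finset ℤ}

instance isProbabilityMeasure_law : IsProbabilityMeasure (law Λ) :=
  inferInstanceAs (IsProbabilityMeasure (stdGaussian (realLaurent Λ)))

lemma measurable_trig (hsymm : ∀ l ∈ Λ, -l ∈ Λ) (t : ℝ) :
    Measurable fun P : realLaurent Λ => trig P t := by
  simp_rw [← inner_evalVec hsymm]
  fun_prop

lemma ae_finite_zeros_trig (hsymm : ∀ l ∈ Λ, -l ∈ Λ) (hne : Λ.Nonempty) :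
    ∀ᵐ P ∂law Λ, (zeros (trig P) (2 * π)).Finite :=
  (ae_separable_poly hsymm hne).mono fun _ => finite_zeros_trig

lemma ae_tendsto_card_signChangeCells_trig (hsymm : ∀ l ∈ Λ, -l ∈ Λ) (hne : Λ.Nonempty) :
    ∀ᵐ P ∂law Λ, Tendsto (fun n => ((signChangeCells (trig P) (2 * π) n).card : ℝ)) atTop
      (𝓝 (zeros (trig P) (2 * π)).ncard) :=
  ae_tendsto_card_signChangeCells Real.two_pi_pos (.of_forall continuous_trig)
    (ae_finite_zeros_trig hsymm hne)
    ((ae_separable_poly hsymm hne).mono fun _ hsep _ hθ => deriv_trig_ne_zero hsep hθ.2)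
    (ae_trig_ne_zero hsymm hne)

lemma numRealRoots_eq_ncard_zeros (P : realLaurent Λ) :
    numRealRoots P = (zeros (trig P) (2 * π)).ncard := by
  rw [numRealRoots, ncard_realRoots]

lemma integrable_numRealRoots (hsymm : ∀ l ∈ Λ, -l ∈ Λ) (hne : Λ.Nonempty) :
    Integrable (fun P : realLaurent Λ => numRealRoots P) (law Λ) := by
  simp_rw [numRealRoots_eq_ncard_zeros]
  refine integrable_ncard_zeros (N := 2 * degree Λ) (measurable_trig hsymm) ?_
    (ae_tendsto_card_signChangeCells_trig hsymm hne)
  filter_upwards [ae_separable_poly hsymm hne, ae_ncard_roots hsymm hne] with P hsep hroots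
  exact (ncard_zeros_trig_le hsep).trans_eq hroots

lemma integral_numRealRoots (hsymm : ∀ l ∈ Λ, -l ∈ Λ) (hne : Λ.Nonempty) :
    ∫ P : realLaurent Λ, numRealRoots P ∂law Λ = 2 * rms Λ fun m => (m : ℝ) := by
  have hint := integrable_numRealRoots hsymm hne
  simp_rw [numRealRoots_eq_ncard_zeros] at hint ⊢
  exact tendsto_nhds_unique
    (tendsto_integral_card_signChangeCells Real.two_pi_pos.le (measurable_trig hsymm)
      (.of_forall continuous_trig) (ae_finite_zeros_trig hsymm hne) hint
      (ae_tendsto_card_signChangeCells_trig hsymm hne))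
    (tendsto_integral_card_signChangeCells_trig hsymm hne)

lemma probRootReal_eq (hsymm : ∀ l ∈ Λ, -l ∈ Λ) (hne : Λ.Nonempty) :
    probRootReal Λ = (1 / (degree Λ : ℝ)) * rms Λ fun m => (m : ℝ) := by
  have hroots : ∀ᵐ P : realLaurent Λ ∂law Λ,
      numRealRoots P / ((roots (P : ℂ[T;T⁻¹])).ncard : ℝ) = numRealRoots P / (2 * degree Λ) := by
    filter_upwards [ae_ncard_roots hsymm hne] with P hP
    rw [hP, Nat.cast_mul, Nat.cast_two]
  rw [probRootReal, integral_congr_ae hroots, integral_div, integral_numRealRoots hsymm hne,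
    mul_div_mul_left _ _ two_ne_zero, div_eq_mul_one_div, mul_comm]

lemma degree_image_mul (Λ : Finset ℤ) (k : ℤ) :
    degree (Λ.image fun l => k * l) = k.natAbs * degree Λ := by
  rw [degree, degree, Finset.sup_image, Finset.mul_sup₀]
  exact Finset.sup_congr rfl fun l _ => Int.natAbs_mul k l

lemma rms_image_mul (Λ : Finset ℤ) {k : ℤ} (hk : k ≠ 0) :
    rms (Λ.image fun l => k * l) (fun m => (m : ℝ)) = |(k : ℝ)| * rms Λ fun m => (m : ℝ) := by
  have hinj : Function.Injective fun l : ℤ => k * l := mul_right_injective₀ hk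
  rw [← rms_const_mul, rms, rms, Finset.card_image_of_injective _ hinj,
    Finset.sum_image hinj.injOn]
  push_cast
  rfl

lemma probRootReal_image_mul (hsymm : ∀ l ∈ Λ, -l ∈ Λ) (hne : Λ.Nonempty) {k : ℤ} (hk : k ≠ 0) :
    probRootReal (Λ.image fun l => k * l) = probRootReal Λ := by
  have hk' : |(k : ℝ)| ≠ 0 := abs_ne_zero.2 (Int.cast_ne_zero.2 hk)
  have hsymm' : ∀ l ∈ Λ.image fun l => k * l, -l ∈ Λ.image fun l => k * l := by
    intro l hl
    obtain ⟨m, hm, rfl⟩ := Finset.mem_image.1 hl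
    exact Finset.mem_image.2 ⟨-m, hsymm m hm, mul_neg k m⟩
  rw [probRootReal_eq hsymm' (hne.image _), probRootReal_eq hsymm hne, degree_image_mul,
    rms_image_mul Λ hk, Nat.cast_mul, Nat.cast_natAbs, Int.cast_abs]
  field_simp

end ExpectedRealRoots

end RandomLaurent

end

theorem theorem3 (Λ : Finset ℤ) (hne : Λ.Nonempty) (hsymm : ∀ l ∈ Λ, -l ∈ Λ) :
    (Integrable (fun P : RandomLaurent.realLaurent Λ => RandomLaurent.numRealRoots P)
        (RandomLaurent.law Λ) ∧
      ∫ P : RandomLaurent.realLaurent Λ, RandomLaurent.numRealRoots P ∂(RandomLaurent.law Λ) =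
        2 * √((1 / (Λ.card : ℝ)) * ∑ l ∈ Λ, (l : ℝ) ^ 2)) ∧
    (Λ ≠ {0} →
      RandomLaurent.probRootReal Λ =
        (1 / (RandomLaurent.degree Λ : ℝ)) * √((1 / (Λ.card : ℝ)) * ∑ l ∈ Λ, (l : ℝ) ^ 2)) ∧
    (Λ ≠ {0} → ∀ k : ℤ, k ≠ 0 →
      RandomLaurent.probRootReal (Λ.image (fun l => k * l)) = RandomLaurent.probRootReal Λ) :=
  ⟨⟨RandomLaurent.integrable_numRealRoots hsymm hne,
      RandomLaurent.integral_numRealRoots hsymm hne⟩,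
    fun _ => RandomLaurent.probRootReal_eq hsymm hne,
    fun _ _ hk => RandomLaurent.probRootReal_image_mul hsymm hne hk⟩
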